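/- Let $\mathbb D=\{z\in\mathbb C:|z|<1\}$ and $\mathbb D(c,r)=\{z:|z-c|<r\}$. A non-empty family $\mathfrak M$ of functions $h$ analytic in $\mathbb D$ with $h'\neq0$ in $\mathbb D$, $h(0)=0$, $h'(0)=1$ is called a linear invariant family if for every $h\in\mathfrak M$ and every $\phi(z)=e^{i\theta}\frac{z+a}{1+\overline a z}$ ($|a|<1$, $\theta\in\mathbb R$) the function $\frac{h(\phi(z))-h(\phi(0))}{h'(\phi(0))\phi'(0)}$ belongs to $\mathfrak M$; its order is $\sup_{h\in\mathfrak M}|h''(0)/2|$. Let $\mathcal U_\alpha$ be the union of all linear invariant families of order at most $\alpha$. Let $0<\alpha<\infty$, $1\le Q\le\infty$, and $k=(Q-1)/(Q+1)$ ($k=1$ if $Q=\infty$). Let $\mathcal H(\alpha,Q)$ be the set of all locally univalent, sense-preserving ($|g'|<|h'|$) harmonic mappings $f=h+\overline g$ of $\mathbb D$, with $h,g$ analytic in $\mathbb D$, $h(0)=g(0)=0$, such that $h'(0)+\overline{g'(0)}=1$, $h/h'(0)\in\mathcal U_\alpha$, and $|g'(z)/h'(z)|\le k$ for all $z\in\mathbb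 D$. (The classes $\mathcal U_\alpha$ and $\mathcal H(\alpha,Q)$ are empty for $\alpha<1$.) A function $f$ on $\mathbb D$ is called convex in a disk $\mathbb D(c,r)\subset\mathbb D$ if it maps that disk univalently onto a convex domain. The radius of convexity of a family of functions on $\mathbb D$ is the largest $r\in(0,1]$ such that every member of the family is convex in $\mathbb D(0,r)$. Put $$\alpha_1=\alpha+k^{-1}-\sqrt{k^{-2}-1}\quad(\alpha_1=\alpha\text{ if }k=0),\qquad R_0=\alpha_1-\sqrt{\alpha_1^2-1}.$$ If $f\in\mathcal H(\alpha,Q)$, then for every $z\in\mathbb D$ the function $f$ is convex in the disk $\mathbb D(z,R(z))$ (in particular, $R(z)>0$ and this disk lies in $\mathbb D$), where $$R(z)=\frac12\left(R_0+R_0^{-1}-\sqrt{(R_0-R_0^{-1})^2+4|z|^2}\right).$$ In particular, the radius of convexity of $\mathcal H(\alpha,Q)$ exists and is no less than $R_0$ (for $\alpha<1$, where the family is empty, it is $1$ by convention, and $\sqrt{\alpha_1^2-1}$ is read as $0$ if $\alpha_1<1$). -/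

import Mathlib

noncomputable section

namespace HarmonicMap

open scoped ENNReal ComplexConjugate

/-- The open unit disk. Functions on the disk are represented by functions `ℂ → ℂ`; all the
notions below depend only on the values in the disk. -/
abbrev disk : Set ℂ := Metric.ball 0 1

/-- The conformal automorphism `z ↦ e^{iθ} (z + a) / (1 + conj a * z)` of the disk (`‖a‖ < 1`). -/
def diskAut (θ : ℝ) (a : ℂ) (z : ℂ) : ℂ :=
  Complex.exp (θ * Complex.I) * ((z + a) / (1 + conj a * z))

/-- The transform `H_φ(z) = (h(φ(z)) - h(φ(0))) / (h'(φ(0)) φ'(0))`. -/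
def koebeTransform (h φ : ℂ → ℂ) (z : ℂ) : ℂ :=
  (h (φ z) - h (φ 0)) / (deriv h (φ 0) * deriv φ 0)

/-- Linear invariant families of analytic locally univalent normalized functions in the disk. -/
structure IsLinearInvariantFamily (M : Set (ℂ → ℂ)) : Prop where
  nonempty : M.Nonempty
  analytic : ∀ h ∈ M, DifferentiableOn ℂ h disk
  locallyUnivalent : ∀ h ∈ M, ∀ z ∈ disk, deriv h z ≠ 0
  map_zero : ∀ h ∈ M, h 0 = 0
  deriv_zero : ∀ h ∈ M, deriv h 0 = 1
  invariant : ∀ h ∈ M, ∀ (θ : ℝ) (a : ℂ), ‖a‖ < 1 → koebeTransform h (diskAut θ a) ∈ M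

/-- The order `sup |a₂(h)|`, `h ∈ M`, where `a₂(h) = h''(0) / 2`. -/
def familyOrder (M : Set (ℂ → ℂ)) : ℝ≥0∞ :=
  ⨆ h ∈ M, ‖iteratedDeriv 2 h 0 / 2‖ₑ

/-- The universal family `𝒰_α`: the union of all linear invariant families of order at most
`α`. -/
def universalLIF (α : ℝ) : Set (ℂ → ℂ) :=
  {h | ∃ M : Set (ℂ → ℂ),
    IsLinearInvariantFamily M ∧ familyOrder M ≤ ENNReal.ofReal α ∧ h ∈ M}

/-- `k = (Q - 1) / (Q + 1)`, with `k = 1` for `Q = ∞`. -/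
def dilatationBound (Q : ℝ≥0∞) : ℝ :=
  if Q = ⊤ then 1 else (Q.toReal - 1) / (Q.toReal + 1)

/-- The class `ℋ(α, Q)` of locally univalent `Q`-quasiconformal harmonic mappings
`f = h + conj g` of the disk with `h(0) = g(0) = 0`, normalized by `a₁ + a₋₁ = 1`, where
`a₁ = h'(0)` and `a₋₁ = conj (g'(0))`, and with `h / h'(0)` in `𝒰_α`. -/
def classH (α : ℝ) (Q : ℝ≥0∞) : Set (ℂ → ℂ) :=
  {f | ∃ h g : ℂ → ℂ,
    DifferentiableOn ℂ h disk ∧ DifferentiableOn ℂ g disk ∧ h 0 = 0 ∧ g 0 = 0 ∧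
    (∀ z ∈ disk, f z = h z + conj (g z)) ∧
    -- locally univalent
    (∀ z ∈ disk, ∃ U ∈ nhds z, Set.InjOn f U) ∧
    -- sense-preserving: positive Jacobian
    (∀ z ∈ disk, 0 < ‖deriv h z‖ ^ 2 - ‖deriv g z‖ ^ 2) ∧
    -- `Q`-quasiconformal: bound on the dilatation
    (∀ z ∈ disk, ‖deriv g z / deriv h z‖ ≤ dilatationBound Q) ∧
    deriv h 0 + conj (deriv g 0) = 1 ∧
    (fun z => h z / deriv h 0) ∈ universalLIF α}

/-- `f` is convex in the disk `𝔻(c, r)` (contained in the unit disk, where `f` lives): it maps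
`𝔻(c, r)` univalently onto a convex domain, i.e. a nonempty open convex set. -/
def ConvexInDisk (f : ℂ → ℂ) (c : ℂ) (r : ℝ) : Prop :=
  Metric.ball c r ⊆ disk ∧ Set.InjOn f (Metric.ball c r) ∧
    (f '' Metric.ball c r).Nonempty ∧ IsOpen (f '' Metric.ball c r) ∧
    Convex ℝ (f '' Metric.ball c r)

/-- `ρ` is the radius of convexity of the family `F`: the largest number in `(0, 1]` such that
every member of `F` is convex in the disk `𝔻(0, ρ)`. -/
def IsRadiusOfConvexity (F : Set (ℂ → ℂ)) (ρ : ℝ) : Prop :=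
  IsGreatest {r : ℝ | 0 < r ∧ r ≤ 1 ∧ ∀ f ∈ F, ConvexInDisk f 0 r} ρ

/-- `α₁ = α + k⁻¹ - √(k⁻² - 1)`, which is read as its limit `α` for `k = 0`. -/
def alphaOne (α : ℝ) (Q : ℝ≥0∞) : ℝ :=
  if dilatationBound Q = 0 then α
  else α + (dilatationBound Q)⁻¹ - √((dilatationBound Q)⁻¹ ^ 2 - 1)

/-- `R₀ = α₁ - √(α₁² - 1)`. -/
def rZero (α : ℝ) (Q : ℝ≥0∞) : ℝ :=
  alphaOne α Q - √(alphaOne α Q ^ 2 - 1)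

/-- `R(z) = (R₀ + R₀⁻¹ - √((R₀ - R₀⁻¹)² + 4 |z|²)) / 2`. -/
def convexityRadiusAt (α : ℝ) (Q : ℝ≥0∞) (z : ℂ) : ℝ :=
  (1 / 2) * (rZero α Q + (rZero α Q)⁻¹
    - √((rZero α Q - (rZero α Q)⁻¹) ^ 2 + 4 * ‖z‖ ^ 2))

end HarmonicMap

end

/-!
Write `f = h + conj g` and `ω = g' / h'`. The proof is a curvature computation on an arbitrary
circle `|ζ - c| = s` inside the disk, followed by a passage from positive curvature to convexity.

*Two invariant bounds.* Evaluating the second coefficient of the Koebe transforms of `h` shows that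
`|(1 - |z|²) h'' / (2 h') - conj z| ≤ α` (`IsLinearInvariantFamily.preSchwarzianBound`). The
Schwarz-Pick inequality for `ω / k` gives `(1 - |z|²) |ω'| ≤ 2 κ (1 - |ω|)` with
`κ = k⁻¹ - √(k⁻² - 1) = α₁ - α` (`dilatation_deriv_le`); for `k = 0` the dilatation vanishes.

*Curvature.* Let `q = 1 + (ζ - c) h'' / h'`. The tangent angle of `t ↦ f (c + s e^{it})` increases
as soon as `(1 - |ω|²) Re q > |ζ - c| |ω'| (1 + |ω|)` (`re_curvature_pos`). Since
`2 Re ((ζ - c) conj ζ) = |ζ|² + s² - |c|²`, the first bound reads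
`(1 - |ζ|²) Re q ≥ 1 + s² - |c|² - 2 α s` on the circle, and together with the second one the
tangent angle increases if `1 + s² - |c|² - 2 α₁ s > 0`, which is `s < R(c)`
(`ConvexityData.curvature_pos`). Working with a general centre makes it unnecessary to transport `f`
by automorphisms of the disk.

*Convexity.* An explicit logarithm of the velocity, built from a logarithm of `h'` and the principal
logarithm of `1 - conj ((ζ - c) g') / ((ζ - c) h')`, shows that the tangent angle grows by exactly
`2π`. Hence the boundary curve lies strictly on one side of each of its tangents, and by the maximum
principle and the openness of `f` so does the image of the disk (`ConvexityData.exists_supporting`).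
This separates boundary points from all other points of the closed disk; applied to all
concentric circles it gives injectivity, and it identifies the image with the intersection of the
supporting half-planes, in which it is open and closed (`convex_image_ball_of_supporting`).

*The case `α < 1`.* The first bound would make `Re (z h'' / h')` positive on the circles `|z| = r`
with `α < r < 1`, although this harmonic function vanishes at `0`; so the class is then empty
(`PreSchwarzianBound.one_le`).
-/

namespace HarmonicMap

open scoped ENNReal ComplexConjugate
open Set Metric

/-! ### Increasing unions and plane curves with increasing tangent angle -/

/-- Convexity in concentric disks of radii increasing to `ρ` passes to the radius `ρ`: the image of
the large disk is the increasing union of the images of the smaller ones. -/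
theorem convexInDisk_of_forall_lt {f : ℂ → ℂ} {c : ℂ} {ρ : ℝ} (hρ : 0 < ρ)
    (H : ∀ s < ρ, ∃ r ∈ Ioc s ρ, ConvexInDisk f c r) : ConvexInDisk f c ρ := by
  have hU : ball c ρ = ⋃ r : {r // r ≤ ρ ∧ ConvexInDisk f c r}, ball c r := by
    ext z
    simp only [mem_ball, mem_iUnion, Subtype.exists, exists_prop]
    constructor
    · intro hz
      obtain ⟨r, hr, hc⟩ := H _ hz
      exact ⟨r, ⟨hr.2, hc⟩, hr.1⟩
    · rintro ⟨r, hr, h⟩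
      exact h.trans_le hr.1
  refine ⟨?_, ?_, ⟨f c, c, mem_ball_self hρ, rfl⟩, ?_, ?_⟩
  · rw [hU]
    exact iUnion_subset fun r => r.2.2.1
  · intro x hx y hy hxy
    obtain ⟨r, hr, hc⟩ := H _ (max_lt (mem_ball.1 hx) (mem_ball.1 hy))
    exact hc.2.1 (mem_ball.2 ((le_max_left _ _).trans_lt hr.1))
      (mem_ball.2 ((le_max_right _ _).trans_lt hr.1)) hxy
  · rw [hU, image_iUnion]
    exact isOpen_iUnion fun r => r.2.2.2.2.2.1
  · rw [hU, image_iUnion]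
    refine Directed.convex_iUnion ?_ fun {r} => r.2.2.2.2.2.2
    exact Monotone.directed_le
      (f := fun r : {r // r ≤ ρ ∧ ConvexInDisk f c r} => f '' ball c r)
      fun s t hst => image_mono (ball_subset_ball hst)

/-- A closed curve of period `T` with velocity `m e^{iψ}`, `m > 0`, whose tangent angle `ψ` increases
by exactly `2π` over a period lies strictly to the left of each of its tangents. Multiplication by
`i e^{-iψ(t₀)}` turns the left normal at `t₀` into the negative real direction. -/
theorem supporting_halfPlane_of_strictMono_angle {γ : ℝ → ℂ} {m ψ : ℝ → ℝ} {T : ℝ} (t₀ : ℝ)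
    (hm : ∀ t, 0 < m t) (hψ : StrictMono ψ) (hψc : Continuous ψ)
    (hγ : ∀ t, HasDerivAt γ (m t * Complex.exp (ψ t * Complex.I)) t)
    (hT : ψ (t₀ + T) = ψ t₀ + 2 * Real.pi) (hγT : γ (t₀ + T) = γ t₀)
    {t : ℝ} (ht : t₀ < t) (htT : t < t₀ + T) :
    ((γ t - γ t₀) * (Complex.I * Complex.exp (-(ψ t₀ * Complex.I)))).re < 0 := by
  set L : ℝ → ℝ := fun t => ((γ t - γ t₀) * (Complex.I * Complex.exp (-(ψ t₀ * Complex.I)))).re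
  have hL : ∀ t, HasDerivAt L (-(m t * Real.sin (ψ t - ψ t₀))) t := by
    intro t
    have h1 := ((hγ t).sub_const (γ t₀)).mul_const
      (Complex.I * Complex.exp (-(ψ t₀ * Complex.I)))
    have h2 := (Complex.reCLM.hasFDerivAt (x := (γ t - γ t₀) *
      (Complex.I * Complex.exp (-(ψ t₀ * Complex.I))))).comp_hasDerivAt t h1
    refine h2.congr_deriv ?_
    have : (m t : ℂ) * Complex.exp (ψ t * Complex.I) *
        (Complex.I * Complex.exp (-(ψ t₀ * Complex.I)))
        = (m t : ℝ) * (Complex.I * Complex.exp ((ψ t - ψ t₀ : ℝ) * Complex.I)) := by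
      have : ((ψ t - ψ t₀ : ℝ) : ℂ) * Complex.I = ψ t * Complex.I + -(ψ t₀ * Complex.I) := by
        push_cast; ring
      rw [this, Complex.exp_add]; ring
    rw [this, Complex.reCLM_apply, Complex.re_ofReal_mul, Complex.I_mul_re,
      Complex.exp_ofReal_mul_I_im]
    ring
  have hLc : Continuous L := continuous_iff_continuousAt.2 fun t => (hL t).continuousAt
  have hL0 : L t₀ = 0 := by simp [L]
  have hLT : L (t₀ + T) = 0 := by simp [L, hγT]
  -- the angle is `ψ t₀ + π` at `t₁`; before it `L` decreases, after it `L` increases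
  obtain ⟨t₁, ht₁, hψ₁⟩ : ∃ t₁ ∈ Icc t₀ (t₀ + T), ψ t₁ = ψ t₀ + Real.pi :=
    intermediate_value_Icc (ht.trans htT).le hψc.continuousOn
      ⟨by linarith [Real.pi_pos], by rw [hT]; linarith [Real.pi_pos]⟩
  rcases le_total t t₁ with h | h
  · have : StrictAntiOn L (Icc t₀ t₁) := by
      refine strictAntiOn_of_deriv_neg (convex_Icc _ _) hLc.continuousOn fun x hx => ?_
      rw [interior_Icc] at hx
      rw [(hL x).deriv, neg_lt_zero]
      exact mul_pos (hm x) (Real.sin_pos_of_pos_of_lt_pi (by linarith [hψ hx.1])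
        (by linarith [hψ hx.2]))
    calc L t < L t₀ := this ⟨le_rfl, ht₁.1⟩ ⟨ht.le, h⟩ ht
      _ = 0 := hL0
  · have : StrictMonoOn L (Icc t₁ (t₀ + T)) := by
      refine strictMonoOn_of_deriv_pos (convex_Icc _ _) hLc.continuousOn fun x hx => ?_
      rw [interior_Icc] at hx
      rw [(hL x).deriv, Left.neg_pos_iff]
      refine mul_neg_of_pos_of_neg (hm x) ?_
      have h1 := hψ hx.1
      have h2 := hψ hx.2
      have := Real.sin_pos_of_pos_of_lt_pi (x := ψ x - ψ t₀ - Real.pi) (by linarith) (by linarith)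
      rw [Real.sin_sub_pi] at this
      linarith
    calc L t < L (t₀ + T) := this ⟨h, htT.le⟩ ⟨ht₁.2, le_rfl⟩ htT
      _ = 0 := hLT

/-! ### Automorphisms of the disk -/

theorem differentiableAt_of_disk {h : ℂ → ℂ} (hd : DifferentiableOn ℂ h disk) {z : ℂ}
    (hz : z ∈ disk) : DifferentiableAt ℂ h z :=
  hd.differentiableAt (isOpen_ball.mem_nhds hz)

theorem one_add_conj_mul_ne_zero {a z : ℂ} (ha : ‖a‖ < 1) (hz : ‖z‖ ≤ 1) : 1 + conj a * z ≠ 0 := by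
  intro h
  have h1 : ‖conj a * z‖ = 1 := by
    rw [eq_neg_of_add_eq_zero_right h]; simp
  rw [norm_mul, Complex.norm_conj] at h1
  nlinarith [norm_nonneg a, norm_nonneg z]

theorem diskAut_zero_apply (a z : ℂ) : diskAut 0 a z = (z + a) / (1 + conj a * z) := by
  simp [diskAut]

theorem hasDerivAt_diskAut {a z : ℂ} (ha : ‖a‖ < 1) (hz : ‖z‖ ≤ 1) :
    HasDerivAt (diskAut 0 a) ((1 - ‖a‖ ^ 2 : ℝ) / (1 + conj a * z) ^ 2) z := by
  have h0 := one_add_conj_mul_ne_zero ha hz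
  have h1 : HasDerivAt (fun z : ℂ => (z + a) / (1 + conj a * z)) _ z :=
    ((hasDerivAt_id z).add_const a).div
    (((hasDerivAt_id z).const_mul (conj a)).const_add 1) h0
  have h2 : diskAut 0 a = fun z : ℂ => (z + a) / (1 + conj a * z) :=
    funext (diskAut_zero_apply a)
  rw [h2]
  refine h1.congr_deriv ?_
  have h3 : ((1 - ‖a‖ ^ 2 : ℝ) : ℂ) = 1 - conj a * a := by
    rw [mul_comm, Complex.mul_conj']; push_cast; ring
  rw [h3]
  simp only [id]
  congr 1; ring

theorem diskAut_mem_disk {a z : ℂ} (ha : ‖a‖ < 1) (hz : z ∈ disk) : diskAut 0 a z ∈ disk := by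
  rw [mem_ball_zero_iff] at hz ⊢
  have h0 := one_add_conj_mul_ne_zero ha hz.le
  rw [diskAut_zero_apply, norm_div, div_lt_one (norm_pos_iff.2 h0)]
  refine lt_of_pow_lt_pow_left₀ 2 (norm_nonneg _) ?_
  have : ‖1 + conj a * z‖ ^ 2 - ‖z + a‖ ^ 2 = (1 - ‖a‖ ^ 2) * (1 - ‖z‖ ^ 2) := by
    simp only [← Complex.normSq_eq_norm_sq, Complex.normSq_apply, Complex.add_re, Complex.add_im,
      Complex.mul_re, Complex.mul_im, Complex.conj_re, Complex.conj_im, Complex.one_re,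
      Complex.one_im]
    ring
  have : 0 < (1 - ‖a‖ ^ 2) * (1 - ‖z‖ ^ 2) :=
    mul_pos (by nlinarith [norm_nonneg a]) (by nlinarith [norm_nonneg z])
  linarith

/-! ### Linear invariant families of bounded order -/

/-- Pommerenke's pointwise form of "order at most `α`": the second coefficient of every Koebe
transform of `h` has modulus at most `α`. -/
def PreSchwarzianBound (α : ℝ) (h : ℂ → ℂ) : Prop :=
  ∀ z ∈ disk, ‖((1 - ‖z‖ ^ 2 : ℝ) : ℂ) * (deriv (deriv h) z / deriv h z) / 2 - conj z‖ ≤ α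

/-- The second coefficient of the Koebe transform of `m` at `a`. -/
theorem iteratedDeriv_two_koebeTransform {m : ℂ → ℂ} (hm : DifferentiableOn ℂ m disk) {a : ℂ}
    (ha : a ∈ disk) (hne : deriv m a ≠ 0) :
    iteratedDeriv 2 (koebeTransform m (diskAut 0 a)) 0 / 2
      = ((1 - ‖a‖ ^ 2 : ℝ) : ℂ) * (deriv (deriv m) a / deriv m a) / 2 - conj a := by
  have ha' : ‖a‖ < 1 := by simpa using ha
  have hb : ((1 - ‖a‖ ^ 2 : ℝ) : ℂ) ≠ 0 := by
    rw [Complex.ofReal_ne_zero]; nlinarith [norm_nonneg a]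
  set b : ℂ := ((1 - ‖a‖ ^ 2 : ℝ) : ℂ)
  have hm' : DifferentiableOn ℂ (deriv m) disk := hm.deriv isOpen_ball
  have hφ0 : diskAut 0 a 0 = a := by simp [diskAut_zero_apply]
  have hφ'0 : deriv (diskAut 0 a) 0 = b := by
    rw [(hasDerivAt_diskAut ha' (by simp)).deriv]; simp [b]
  have hK : ∀ z ∈ disk, deriv (koebeTransform m (diskAut 0 a)) z
      = deriv m (diskAut 0 a z) * (b / (1 + conj a * z) ^ 2) / (deriv m a * b) := by
    intro z hz
    have hz' : ‖z‖ ≤ 1 := (mem_ball_zero_iff.1 hz).le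
    have h1 := (differentiableAt_of_disk hm (diskAut_mem_disk ha' hz)).hasDerivAt.comp z
      (hasDerivAt_diskAut ha' hz')
    have h2 := (h1.sub_const (m a)).div_const (deriv m a * b)
    have h3 : koebeTransform m (diskAut 0 a)
        = fun z => ((m ∘ diskAut 0 a) z - m a) / (deriv m a * b) := by
      funext w; simp [koebeTransform, hφ0, hφ'0]
    rw [h3]; exact h2.deriv
  have h0 : (0 : ℂ) ∈ disk := by simp
  have hev : deriv (koebeTransform m (diskAut 0 a)) =ᶠ[nhds 0] fun z =>
      deriv m (diskAut 0 a z) * (b / (1 + conj a * z) ^ 2) / (deriv m a * b) := by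
    filter_upwards [isOpen_ball.mem_nhds h0] with z hz using hK z hz
  have e1 := (differentiableAt_of_disk hm' (by rwa [hφ0] : diskAut 0 a 0 ∈ disk)).hasDerivAt.comp 0
      (hasDerivAt_diskAut ha' (by simp : ‖(0:ℂ)‖ ≤ 1))
  have e2 : HasDerivAt (fun z : ℂ => b / (1 + conj a * z) ^ 2) (-2 * conj a * b) 0 := by
    have := (hasDerivAt_const (0:ℂ) b).div
      ((((hasDerivAt_id (0:ℂ)).const_mul (conj a)).const_add 1).pow 2) (by simp)
    refine this.congr_deriv ?_
    simp; ring
  have e3 := ((e1.mul e2).div_const (deriv m a * b)).deriv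
  rw [iteratedDeriv_succ, iteratedDeriv_one, hev.deriv_eq]
  refine (congrArg (· / 2) e3).trans ?_
  simp only [Function.comp_apply, hφ0, mul_zero, add_zero, one_pow, div_one]
  change (deriv (deriv m) a * b * b + _) / _ / 2 = _
  field_simp
  ring

theorem IsLinearInvariantFamily.preSchwarzianBound {M : Set (ℂ → ℂ)}
    (hM : IsLinearInvariantFamily M) {α : ℝ} (hα : 0 ≤ α)
    (ho : familyOrder M ≤ ENNReal.ofReal α) {m : ℂ → ℂ} (hm : m ∈ M) :
    PreSchwarzianBound α m := by
  intro a ha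
  rw [← iteratedDeriv_two_koebeTransform (hM.analytic m hm) ha (hM.locallyUnivalent m hm a ha)]
  have hmem := hM.invariant m hm 0 a (by simpa using ha)
  have h1 : ‖iteratedDeriv 2 (koebeTransform m (diskAut 0 a)) 0 / 2‖ₑ ≤ ENNReal.ofReal α :=
    (le_iSup₂ (f := fun h (_ : h ∈ M) => ‖iteratedDeriv 2 h 0 / 2‖ₑ) _ hmem).trans ho
  rwa [← ofReal_norm, ENNReal.ofReal_le_ofReal_iff hα] at h1

theorem PreSchwarzianBound.of_div_const {α : ℝ} {h : ℂ → ℂ} {c : ℂ} (hc : c ≠ 0)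
    (H : PreSchwarzianBound α fun z => h z / c) : PreSchwarzianBound α h := by
  intro z hz
  have h1 : deriv (fun z => h z / c) = fun z => deriv h z / c := funext fun z => deriv_div_const c
  have := H z hz
  rw [h1, deriv_div_const, div_div_div_cancel_right₀ hc] at this
  exact this

/-- The bound in the direction `v`, as a lower estimate for `Re (v h'' / h')`. -/
theorem PreSchwarzianBound.re_le {α : ℝ} {h : ℂ → ℂ} (H : PreSchwarzianBound α h) {z : ℂ}
    (hz : z ∈ disk) (v : ℂ) :
    2 * ((v * conj z).re - α * ‖v‖) ≤
      (1 - ‖z‖ ^ 2) * (v * (deriv (deriv h) z / deriv h z)).re := by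
  set p := deriv (deriv h) z / deriv h z
  have h1 : -(‖v‖ * α) ≤ (v * (((1 - ‖z‖ ^ 2 : ℝ) : ℂ) * p / 2 - conj z)).re := by
    refine (neg_le_neg ?_).trans (neg_le_of_abs_le (Complex.abs_re_le_norm _))
    rw [norm_mul]
    exact mul_le_mul_of_nonneg_left (H z hz) (norm_nonneg _)
  have h2 : v * (((1 - ‖z‖ ^ 2 : ℝ) : ℂ) * p / 2 - conj z)
      = ((1 - ‖z‖ ^ 2 : ℝ) : ℂ) * (v * p) / 2 - v * conj z := by ring
  have h3 : (((1 - ‖z‖ ^ 2 : ℝ) : ℂ) * (v * p) / 2).re = (1 - ‖z‖ ^ 2) * (v * p).re / 2 := by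
    rw [show ((1 - ‖z‖ ^ 2 : ℝ) : ℂ) * (v * p) / 2 = (((1 - ‖z‖ ^ 2) / 2 : ℝ) : ℂ) * (v * p) by
      push_cast; ring, Complex.re_ofReal_mul]
    ring
  rw [h2, Complex.sub_re, h3] at h1
  linarith

/-- If `α < 1`, then `Re (z h'' / h') > 0` on a circle `|z| = r` with `α < r < 1`, and the maximum
principle for `exp (-z h'' / h')` contradicts its value `1` at the origin. -/
theorem PreSchwarzianBound.one_le {α : ℝ} {h : ℂ → ℂ} (hα : 0 ≤ α) (H : PreSchwarzianBound α h)
    (hd : DifferentiableOn ℂ h disk) (hne : ∀ z ∈ disk, deriv h z ≠ 0) : 1 ≤ α := by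
  by_contra! hlt
  set E : ℂ → ℂ := fun z => Complex.exp (-(z * (deriv (deriv h) z / deriv h z)))
  obtain ⟨r, hr, hr1⟩ := exists_between hlt
  have hd1 := hd.deriv isOpen_ball
  have hE : DifferentiableOn ℂ E disk :=
    ((differentiableOn_id.mul ((hd1.deriv isOpen_ball).div hd1 hne)).neg).cexp
  have hr0 : 0 < r := hα.trans_lt hr
  have hsub : closedBall (0 : ℂ) r ⊆ disk := closedBall_subset_ball hr1
  set C : ℝ := Real.exp (-(2 * (r ^ 2 - α * r) / (1 - r ^ 2)))
  have hr2 : 0 < 1 - r ^ 2 := by nlinarith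
  have key : ‖E 0‖ ≤ C := by
    refine Complex.norm_le_of_forall_mem_frontier_norm_le (U := ball 0 r) isBounded_ball
      ((hE.mono ?_).diffContOnCl) (C := C) ?_ (subset_closure (mem_ball_self hr0))
    · rw [closure_ball _ hr0.ne']; exact hsub
    · intro z hz
      rw [frontier_ball _ hr0.ne'] at hz
      have hzr : ‖z‖ = r := by simpa using hz
      have h1 := H.re_le (hsub (sphere_subset_closedBall hz)) z
      rw [Complex.mul_conj', hzr] at h1
      have h4 : (((r : ℂ)) ^ 2).re = r ^ 2 := by rw [← Complex.ofReal_pow, Complex.ofReal_re]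
      rw [h4] at h1
      rw [Complex.norm_exp, Real.exp_le_exp, Complex.neg_re, neg_le_neg_iff, div_le_iff₀ hr2]
      linarith
  have hC : C < 1 := by
    rw [Real.exp_lt_one_iff, neg_lt_zero]
    exact div_pos (by nlinarith) hr2
  simp [E] at key
  linarith

/-! ### The Schwarz-Pick inequality and the dilatation -/

/-- The infinitesimal Schwarz-Pick inequality, for maps into the closed unit disk. -/
theorem schwarz_pick_deriv {F : ℂ → ℂ} (hF : DifferentiableOn ℂ F disk)
    (hb : ∀ z ∈ disk, ‖F z‖ ≤ 1) {z : ℂ} (hz : z ∈ disk) :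
    (1 - ‖z‖ ^ 2) * ‖deriv F z‖ ≤ 1 - ‖F z‖ ^ 2 := by
  have hz1 : ‖z‖ < 1 := by simpa using hz
  -- for `t < 1` the function `t F` maps into the open disk, and `t` may tend to `1`
  have key : ∀ t : ℝ, t ∈ Ioo 0 1 → (1 - ‖z‖ ^ 2) * (t * ‖deriv F z‖) ≤ 1 - (t * ‖F z‖) ^ 2 := by
    intro t ht
    set w : ℂ := t * F z
    have hw' : ‖w‖ = t * ‖F z‖ := by simp [w, abs_of_pos ht.1]
    have hw : ‖w‖ < 1 := by
      rw [hw']; nlinarith [hb z hz, ht.1, ht.2, norm_nonneg (F z)]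
    have hnw : ‖-w‖ < 1 := by rwa [norm_neg]
    set Ψ : ℂ → ℂ := fun ζ => diskAut 0 (-w) (t * F (diskAut 0 z ζ))
    have hmem : ∀ ζ ∈ disk, (t : ℂ) * F (diskAut 0 z ζ) ∈ disk := by
      intro ζ hζ
      have := hb _ (diskAut_mem_disk hz1 hζ)
      rw [mem_ball_zero_iff, norm_mul, Complex.norm_real, Real.norm_of_nonneg ht.1.le]
      nlinarith [ht.1, ht.2, norm_nonneg (F (diskAut 0 z ζ))]
    have hder : ∀ ζ ∈ disk, HasDerivAt Ψ
        (((1 - ‖-w‖ ^ 2 : ℝ) / (1 + conj (-w) * (t * F (diskAut 0 z ζ))) ^ 2)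
          * (t * (deriv F (diskAut 0 z ζ) * ((1 - ‖z‖ ^ 2 : ℝ) / (1 + conj z * ζ) ^ 2)))) ζ := by
      intro ζ hζ
      have h1 := (differentiableAt_of_disk hF (diskAut_mem_disk hz1 hζ)).hasDerivAt.comp ζ
        (hasDerivAt_diskAut hz1 (mem_ball_zero_iff.1 hζ).le)
      have h2 := hasDerivAt_diskAut hnw (mem_ball_zero_iff.1 (hmem ζ hζ)).le
      exact HasDerivAt.comp (h₂ := diskAut 0 (-w)) (h := fun ζ => (t : ℂ) * F (diskAut 0 z ζ)) ζ h2
        (h1.const_mul (t : ℂ))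
    have h0 : (0 : ℂ) ∈ disk := by simp
    have hφ0 : diskAut 0 z 0 = z := by simp [diskAut_zero_apply]
    have hΨ0 : Ψ 0 = 0 := by simp [Ψ, diskAut_zero_apply, w]
    have hle := Complex.norm_deriv_le_one_of_mapsTo_ball (f := Ψ) (c := 0) (R := 1)
      (fun ζ hζ => (hder ζ hζ).differentiableAt.differentiableWithinAt)
      (fun ζ hζ => by
        rw [hΨ0]; exact ball_subset_closedBall (diskAut_mem_disk hnw (hmem ζ hζ))) one_pos
    have hw2 : 0 < 1 - ‖w‖ ^ 2 := by nlinarith [norm_nonneg w]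
    have hz2 : 0 < 1 - ‖z‖ ^ 2 := by nlinarith [norm_nonneg z]
    have h5 : (1 + conj (-w) * w : ℂ) = (1 - ‖w‖ ^ 2 : ℝ) := by
      rw [map_neg, neg_mul, mul_comm, Complex.mul_conj']; push_cast; ring
    rw [(hder 0 h0).deriv, hφ0] at hle
    change ‖((1 - ‖-w‖ ^ 2 : ℝ) : ℂ) / (1 + conj (-w) * w) ^ 2 * _‖ ≤ 1 at hle
    rw [h5, norm_neg] at hle
    simp only [mul_zero, add_zero, one_pow, div_one, norm_mul, norm_div, norm_pow,
      Complex.norm_real, Real.norm_of_nonneg hw2.le, Real.norm_of_nonneg hz2.le,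
      Real.norm_of_nonneg ht.1.le] at hle
    rw [← hw']
    have h6 : (1 - ‖w‖ ^ 2) / (1 - ‖w‖ ^ 2) ^ 2 = (1 - ‖w‖ ^ 2)⁻¹ := by field_simp
    rw [h6, inv_mul_le_iff₀ hw2] at hle
    linarith
  have hlim1 : Filter.Tendsto (fun t : ℝ => (1 - ‖z‖ ^ 2) * (t * ‖deriv F z‖)) (nhdsWithin 1 (Iio 1))
      (nhds ((1 - ‖z‖ ^ 2) * (1 * ‖deriv F z‖))) :=
    (Continuous.tendsto (by fun_prop) 1).mono_left nhdsWithin_le_nhds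
  have hlim2 : Filter.Tendsto (fun t : ℝ => 1 - (t * ‖F z‖) ^ 2) (nhdsWithin 1 (Iio 1))
      (nhds (1 - (1 * ‖F z‖) ^ 2)) :=
    (Continuous.tendsto (by fun_prop) 1).mono_left nhdsWithin_le_nhds
  have := le_of_tendsto_of_tendsto hlim1 hlim2 (by
    filter_upwards [Ioo_mem_nhdsLT (zero_lt_one' ℝ)] with t ht using key t ht)
  simpa using this

/-- The constant `2 (k⁻¹ - √(k⁻² - 1))` is the supremum of `(k² - v²) / (k (1 - v))` over
`v ∈ [0, k]`, `v < 1`, where `v` stands for `‖ω z‖`. -/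
theorem dilatation_deriv_le {k : ℝ} (hk : 0 < k) (hk1 : k ≤ 1) {ω : ℂ → ℂ}
    (hω : DifferentiableOn ℂ ω disk) (hb : ∀ z ∈ disk, ‖ω z‖ ≤ k) {z : ℂ} (hz : z ∈ disk) :
    (1 - ‖z‖ ^ 2) * ‖deriv ω z‖ ≤ 2 * (k⁻¹ - √(k⁻¹ ^ 2 - 1)) * (1 - ‖ω z‖) := by
  have h1 := schwarz_pick_deriv (F := fun z => ω z / k) (hω.div_const _) (fun z hz => by
    rw [norm_div, Complex.norm_real, Real.norm_of_nonneg hk.le]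
    exact (div_le_one hk).2 (hb z hz)) hz
  rw [deriv_div_const, norm_div, norm_div, Complex.norm_real, Real.norm_of_nonneg hk.le] at h1
  have hki : 1 ≤ k⁻¹ := (one_le_inv₀ hk).2 hk1
  have hs := Real.sq_sqrt (show 0 ≤ k⁻¹ ^ 2 - 1 by nlinarith)
  set σ := √(k⁻¹ ^ 2 - 1)
  set v := ‖ω z‖
  have h2 : (1 - ‖z‖ ^ 2) * ‖deriv ω z‖ ≤ k * (1 - (v / k) ^ 2) := by
    calc (1 - ‖z‖ ^ 2) * ‖deriv ω z‖ = k * ((1 - ‖z‖ ^ 2) * (‖deriv ω z‖ / k)) := by field_simp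
      _ ≤ _ := mul_le_mul_of_nonneg_left h1 hk.le
  refine h2.trans ?_
  -- the difference of the two sides is a square, which vanishes at the extremal value
  -- `v = k (k⁻¹ - σ)`
  have h3 : 2 * (k⁻¹ - σ) * (1 - v) - k * (1 - (v / k) ^ 2) = k * (v / k - (k⁻¹ - σ)) ^ 2
      + k * ((k⁻¹ ^ 2 - 1) - σ ^ 2) := by
    field_simp; ring
  rw [hs, sub_self, mul_zero, add_zero] at h3
  nlinarith [mul_nonneg hk.le (sq_nonneg (v / k - (k⁻¹ - σ)))]

/-! ### Curvature of the images of circles -/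

/-- Pointwise form of the curvature estimate, for `A = (ζ - c) h'`, `q = 1 + (ζ - c) h'' / h'` and
`η = (ζ - c) ω'`. Multiplying by the conjugate of the denominator gives
`|A|² (1 - |ω|²) Re q` plus a term of modulus at most `|A|² |η| (1 + |ω|)`. -/
theorem re_curvature_pos {A q ω η : ℂ} (hA : A ≠ 0) (hω : ‖ω‖ < 1)
    (h : ‖η‖ * (1 + ‖ω‖) < (1 - ‖ω‖ ^ 2) * q.re) :
    0 < ((A * q + conj (A * (ω * q + η))) / (A - conj (A * ω))).re := by
  have hApos : 0 < ‖A‖ := norm_pos_iff.2 hA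
  have hD : A - conj (A * ω) ≠ 0 := by
    intro h0
    have := congrArg norm (sub_eq_zero.1 h0)
    rw [Complex.norm_conj, norm_mul] at this
    nlinarith
  have hη : -(‖A‖ ^ 2 * (‖η‖ * (1 + ‖ω‖))) ≤ (conj (A * η) * (conj A - A * ω)).re := by
    refine (neg_le_neg ?_).trans (neg_le_of_abs_le (Complex.abs_re_le_norm _))
    rw [norm_mul, Complex.norm_conj, norm_mul]
    have : ‖conj A - A * ω‖ ≤ ‖A‖ * (1 + ‖ω‖) := by
      refine (norm_sub_le _ _).trans_eq ?_
      rw [Complex.norm_conj, norm_mul]; ring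
    calc ‖A‖ * ‖η‖ * ‖conj A - A * ω‖ ≤ ‖A‖ * ‖η‖ * (‖A‖ * (1 + ‖ω‖)) := by gcongr
      _ = _ := by ring
  have hq : ((A * q + conj (A * (ω * q))) * (conj A - A * ω)).re
      = ‖A‖ ^ 2 * ((1 - ‖ω‖ ^ 2) * q.re) := by
    simp only [← Complex.normSq_eq_norm_sq, Complex.normSq_apply, Complex.add_re, Complex.add_im,
      Complex.sub_re, Complex.sub_im, Complex.mul_re, Complex.mul_im, Complex.conj_re,
      Complex.conj_im]
    ring
  have hN : (A * q + conj (A * (ω * q + η))) * conj (A - conj (A * ω))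
      = (A * q + conj (A * (ω * q))) * (conj A - A * ω) + conj (A * η) * (conj A - A * ω) := by
    simp only [map_sub, Complex.conj_conj, mul_add, map_add]; ring
  have hpos : 0 < ((A * q + conj (A * (ω * q + η))) * conj (A - conj (A * ω))).re := by
    rw [hN, Complex.add_re, hq]
    have := mul_lt_mul_of_pos_left h (pow_pos hApos 2)
    linarith
  rw [div_eq_mul_inv, Complex.inv_def, ← mul_assoc, Complex.re_mul_ofReal]
  exact mul_pos hpos (inv_pos.2 (Complex.normSq_pos.2 hD))

/-- The analytic and co-analytic parts `h`, `g` of a sense-preserving harmonic map of the disk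
together with the two bounds that control convexity: the pre-Schwarzian bound of order `α` for `h`,
and a bound with constant `κ` for the derivative of the dilatation `g' / h'`. -/
structure ConvexityData (h g : ℂ → ℂ) (α κ : ℝ) : Prop where
  diff_h : DifferentiableOn ℂ h disk
  diff_g : DifferentiableOn ℂ g disk
  norm_lt : ∀ z ∈ disk, ‖deriv g z‖ < ‖deriv h z‖
  preSchwarzian : PreSchwarzianBound α h
  dilatation : ∀ z ∈ disk, (1 - ‖z‖ ^ 2) * ‖deriv (fun w => deriv g w / deriv h w) z‖
    ≤ 2 * κ * (1 - ‖deriv g z / deriv h z‖)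

variable {h g : ℂ → ℂ} {α κ : ℝ}

theorem ConvexityData.deriv_ne_zero (H : ConvexityData h g α κ) {z : ℂ} (hz : z ∈ disk) :
    deriv h z ≠ 0 :=
  norm_pos_iff.1 ((norm_nonneg _).trans_lt (H.norm_lt z hz))

/-- The derivative of the tangent angle of `f = h + conj g` along the circle through `z` with centre
`c` is positive if `1 + s² - |c|² - 2 (α + κ) s > 0` for `s = |z - c|`. -/
theorem ConvexityData.curvature_pos (H : ConvexityData h g α κ) {c z : ℂ} (hz : z ∈ disk)
    (hpos : 0 < 1 + ‖z - c‖ ^ 2 - ‖c‖ ^ 2 - 2 * (α + κ) * ‖z - c‖) (hzc : z ≠ c) :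
    0 < (((z - c) * (deriv h z + (z - c) * deriv (deriv h) z)
        + conj ((z - c) * (deriv g z + (z - c) * deriv (deriv g) z)))
      / ((z - c) * deriv h z - conj ((z - c) * deriv g z))).re := by
  have hne := H.deriv_ne_zero hz
  set v := z - c
  have hv : v ≠ 0 := sub_ne_zero.2 hzc
  set p := deriv (deriv h) z / deriv h z
  set ω : ℂ → ℂ := fun w => deriv g w / deriv h w
  have hω1 : ‖ω z‖ < 1 := by
    rw [norm_div]; exact (div_lt_one (norm_pos_iff.2 hne)).2 (H.norm_lt z hz)
  have hz2 : 0 < 1 - ‖z‖ ^ 2 := by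
    have : ‖z‖ < 1 := by simpa using hz
    nlinarith [norm_nonneg z]
  have hω' : deriv ω z = (deriv (deriv g) z * deriv h z - deriv g z * deriv (deriv h) z)
      / deriv h z ^ 2 :=
    ((differentiableAt_of_disk (H.diff_g.deriv isOpen_ball) hz).hasDerivAt.div
      (differentiableAt_of_disk (H.diff_h.deriv isOpen_ball) hz).hasDerivAt hne).deriv
  have hre : 1 + ‖v‖ ^ 2 - ‖c‖ ^ 2 - 2 * α * ‖v‖ ≤ (1 - ‖z‖ ^ 2) * (1 + v * p).re := by
    have h1 := H.preSchwarzian.re_le hz v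
    have h2 : 2 * (v * conj z).re = ‖z‖ ^ 2 + ‖v‖ ^ 2 - ‖c‖ ^ 2 := by
      have : c = z - v := by simp [v]
      rw [this]
      simp only [← Complex.normSq_eq_norm_sq, Complex.normSq_apply, Complex.sub_re, Complex.sub_im,
        Complex.mul_re, Complex.conj_re, Complex.conj_im]
      ring
    rw [Complex.add_re, Complex.one_re, mul_add]
    change _ ≤ (1 - ‖z‖ ^ 2) * (v * p).re at h1
    linarith
  have key := re_curvature_pos (A := v * deriv h z) (q := 1 + v * p) (ω := ω z)
    (η := v * deriv ω z) (mul_ne_zero hv hne) hω1 (by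
      have h3 := H.dilatation z hz
      rw [norm_mul]
      refine lt_of_mul_lt_mul_left ?_ hz2.le
      calc (1 - ‖z‖ ^ 2) * (‖v‖ * ‖deriv ω z‖ * (1 + ‖ω z‖))
          = ‖v‖ * (1 + ‖ω z‖) * ((1 - ‖z‖ ^ 2) * ‖deriv ω z‖) := by ring
        _ ≤ ‖v‖ * (1 + ‖ω z‖) * (2 * κ * (1 - ‖ω z‖)) := by gcongr
        _ = (1 - ‖ω z‖ ^ 2) * (2 * κ * ‖v‖) := by ring
        _ < (1 - ‖ω z‖ ^ 2) * ((1 - ‖z‖ ^ 2) * (1 + v * p).re) := by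
          refine mul_lt_mul_of_pos_left ?_ (by nlinarith [norm_nonneg (ω z)])
          linarith
        _ = _ := by ring)
  convert key using 3
  · congr 1
    · simp only [p]; field_simp
    · congr 1
      rw [hω']; simp only [ω, p]; field_simp; ring
  · simp only [ω]; congr 2; field_simp

/-- A zero-free analytic function in the unit disk has an analytic logarithm. -/
theorem exists_log {h : ℂ → ℂ} (hd : DifferentiableOn ℂ h disk)
    (hne : ∀ z ∈ disk, h z ≠ 0) :
    ∃ l : ℂ → ℂ, DifferentiableOn ℂ l disk ∧ ∀ z ∈ disk, Complex.exp (l z) = h z := by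
  obtain ⟨l, hl0, hl⟩ := (((hd.deriv isOpen_ball).div hd hne).isExactOn_ball).with_val_at 0
    (Complex.log (h 0))
  refine ⟨l, fun z hz => (hl z hz).differentiableAt.differentiableWithinAt, fun z hz => ?_⟩
  have h0 : (0 : ℂ) ∈ disk := by simp
  have hder : ∀ w ∈ disk, HasDerivAt (fun w => h w * Complex.exp (-l w)) 0 w := by
    intro w hw
    refine ((differentiableAt_of_disk hd hw).hasDerivAt.mul (hl w hw).neg.cexp).congr_deriv ?_
    have := hne w hw
    simp only [Pi.div_apply]
    field_simp
    ring
  have hconst := isOpen_ball.is_const_of_deriv_eq_zero (isPreconnected_ball)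
    (fun w hw => (hder w hw).differentiableAt.differentiableWithinAt)
    (fun w hw => (hder w hw).deriv) hz h0
  have e0 : h 0 * Complex.exp (-l 0) = 1 := by
    rw [hl0, Complex.exp_neg, Complex.exp_log (hne 0 h0), mul_inv_cancel₀ (hne 0 h0)]
  have e1 : h z * Complex.exp (-l z) = 1 := hconst.trans e0
  rw [Complex.exp_neg] at e1
  exact (eq_of_div_eq_one e1).symm

/-! ### Supporting half-planes -/

theorem ConvexityData.exists_supporting_on_sphere (H : ConvexityData h g α κ) {c : ℂ} {s : ℝ}
    (hs : 0 < s) (hsub : closedBall c s ⊆ disk)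
    (hpos : 0 < 1 + s ^ 2 - ‖c‖ ^ 2 - 2 * (α + κ) * s) {z₀ : ℂ} (hz₀ : z₀ ∈ sphere c s) :
    ∃ e : ℂ, e ≠ 0 ∧ ∀ z ∈ sphere c s, z ≠ z₀ →
      (((h z + conj (g z)) - (h z₀ + conj (g z₀))) * e).re < 0 := by
  have hmem : ∀ t, circleMap c s t ∈ disk := fun t => hsub (circleMap_mem_closedBall c hs.le t)
  have hh' := H.diff_h.deriv isOpen_ball
  have hg' := H.diff_g.deriv isOpen_ball
  obtain ⟨l, hld, hl⟩ := exists_log hh' fun z hz => H.deriv_ne_zero hz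
  set v : ℝ → ℂ := circleMap 0 s
  have hv : ∀ t, circleMap c s t - c = v t := fun t => by simp [v, circleMap]
  have hv0 : ∀ t, v t ≠ 0 := fun t => circleMap_ne_center hs.ne'
  have hvexp : ∀ t, v t = s * Complex.exp (t * Complex.I) := fun t => by simp [v, circleMap]
  have hζ' : ∀ t, HasDerivAt (circleMap c s) (v t * Complex.I) t := hasDerivAt_circleMap c s
  have hv' : ∀ t, HasDerivAt v (v t * Complex.I) t := hasDerivAt_circleMap 0 s
  have hcomp : ∀ {u : ℂ → ℂ}, DifferentiableOn ℂ u disk → ∀ t : ℝ,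
      HasDerivAt (fun t => u (circleMap c s t))
        (deriv u (circleMap c s t) * (v t * Complex.I)) t := fun hu t =>
    (differentiableAt_of_disk hu (hmem t)).hasDerivAt.comp t (hζ' t)
  have hconj : ∀ {u : ℝ → ℂ} {u' : ℂ} {t : ℝ}, HasDerivAt u u' t →
      HasDerivAt (fun t => conj (u t)) (conj u') t := fun {u u' t} hu =>
    Complex.conjCLE.hasFDerivAt.comp_hasDerivAt t hu
  set A : ℝ → ℂ := fun t => v t * deriv h (circleMap c s t)
  set B : ℝ → ℂ := fun t => v t * deriv g (circleMap c s t)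
  have hA0 : ∀ t, A t ≠ 0 := fun t => mul_ne_zero (hv0 t) (H.deriv_ne_zero (hmem t))
  have hS : ∀ t, ‖conj (B t) / A t‖ < 1 := fun t => by
    rw [norm_div, Complex.norm_conj, div_lt_one (norm_pos_iff.2 (hA0 t)), norm_mul, norm_mul]
    exact mul_lt_mul_of_pos_left (H.norm_lt _ (hmem t)) (norm_pos_iff.2 (hv0 t))
  have hslit : ∀ t, 1 - conj (B t) / A t ∈ Complex.slitPlane := fun t => by
    rw [sub_eq_add_neg]
    exact Complex.mem_slitPlane_of_norm_lt_one (by rw [norm_neg]; exact hS t)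
  have hA' : ∀ t, HasDerivAt A (v t * Complex.I * deriv h (circleMap c s t) + v t *
      (deriv (deriv h) (circleMap c s t) * (v t * Complex.I))) t := fun t =>
    (hv' t).mul (hcomp hh' t)
  have hB' : ∀ t, HasDerivAt B (v t * Complex.I * deriv g (circleMap c s t) + v t *
      (deriv (deriv g) (circleMap c s t) * (v t * Complex.I))) t := fun t =>
    (hv' t).mul (hcomp hg' t)
  -- `Λ` is a logarithm of the velocity `i (A - conj B)` of the boundary curve
  set Λ : ℝ → ℂ := fun t => l (circleMap c s t) + Complex.log (s * Complex.I) + t * Complex.I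
    + Complex.log (1 - conj (B t) / A t)
  have hΛexp : ∀ t, Complex.exp (Λ t) = Complex.I * (A t - conj (B t)) := by
    intro t
    have hs' : (s * Complex.I : ℂ) ≠ 0 :=
      mul_ne_zero (Complex.ofReal_ne_zero.2 hs.ne') Complex.I_ne_zero
    simp only [Λ]
    rw [Complex.exp_add, Complex.exp_add, Complex.exp_add, hl _ (hmem t), Complex.exp_log hs',
      Complex.exp_log (Complex.slitPlane_ne_zero (hslit t))]
    have h1 : deriv h (circleMap c s t) * (s * Complex.I) * Complex.exp (t * Complex.I)
        = Complex.I * A t := by simp only [A]; rw [hvexp]; ring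
    rw [h1]
    have := hA0 t
    field_simp
  -- the derivative of `Λ` need not be computed from its definition: it is the logarithmic
  -- derivative of the velocity
  have hΛd : Differentiable ℝ Λ := by
    intro t
    have h1 := (hcomp hld t).differentiableAt
    have h2 : DifferentiableAt ℝ (fun t : ℝ => (t : ℂ) * Complex.I) t :=
      ((hasDerivAt_id t).ofReal_comp.mul_const _).differentiableAt
    have h3 := (((hconj (hB' t)).div (hA' t) (hA0 t)).const_sub 1).clog_real (hslit t)
    exact ((h1.add_const _).add h2).add h3.differentiableAt
  have hΛ' : ∀ t, 0 < (deriv Λ t).im := by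
    intro t
    have h1 := (hΛd t).hasDerivAt.cexp
    have h2 := ((hA' t).sub (hconj (hB' t))).const_mul Complex.I
    have h3 : (fun t => Complex.exp (Λ t)) = fun t => Complex.I * (A t - conj (B t)) :=
      funext hΛexp
    rw [h3, hΛexp] at h1
    have h4 := h1.unique h2
    have hD : A t - conj (B t) ≠ 0 := fun h0 => by
      have := hΛexp t
      rw [h0, mul_zero] at this
      exact Complex.exp_ne_zero _ this
    have h5 := H.curvature_pos (c := c) (z := circleMap c s t) (hmem t)
      (by rw [hv, show ‖v t‖ = s by simp [v, abs_of_pos hs]]; exact hpos)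
      (circleMap_ne_center hs.ne')
    rw [hv] at h5
    change 0 < ((_ + _) / (A t - conj (B t))).re at h5
    rw [← Complex.I_mul_im] at h5
    convert h5 using 2
    rw [← mul_div_assoc, eq_div_iff hD]
    rw [mul_assoc] at h4
    rw [mul_comm, mul_left_cancel₀ Complex.I_ne_zero h4]
    simp only [map_add, map_mul, Complex.conj_I]
    ring
  have hγ : ∀ t, HasDerivAt (fun t => h (circleMap c s t) + conj (g (circleMap c s t)))
      ((Real.exp (Λ t).re : ℝ) * Complex.exp ((Λ t).im * Complex.I)) t := by
    intro t
    refine ((hcomp H.diff_h t).add (hconj (hcomp H.diff_g t))).congr_deriv ?_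
    rw [Complex.ofReal_exp, ← Complex.exp_add, Complex.re_add_im, hΛexp]
    simp only [A, B, map_mul, Complex.conj_I]
    ring
  have hψ' : ∀ t, HasDerivAt (fun t => (Λ t).im) (deriv Λ t).im t := fun t =>
    Complex.imCLM.hasFDerivAt.comp_hasDerivAt t (hΛd t).hasDerivAt
  have hmono : StrictMono fun t => (Λ t).im :=
    strictMono_of_deriv_pos fun t => by rw [(hψ' t).deriv]; exact hΛ' t
  obtain ⟨t₀, -, rfl⟩ : z₀ ∈ circleMap c s '' Ico 0 (0 + 2 * Real.pi) := by
    have : z₀ ∈ range (circleMap c s) := by rw [range_circleMap, abs_of_pos hs]; exact hz₀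
    obtain ⟨t, rfl⟩ := this
    obtain ⟨y, hy, e⟩ := (periodic_circleMap c s).exists_mem_Ico Real.two_pi_pos t 0
    exact ⟨y, hy, e.symm⟩
  refine ⟨Complex.I * Complex.exp (-((Λ t₀).im * Complex.I)),
    mul_ne_zero Complex.I_ne_zero (Complex.exp_ne_zero _), fun z hz hne => ?_⟩
  obtain ⟨t, rfl⟩ : z ∈ range (circleMap c s) := by rw [range_circleMap, abs_of_pos hs]; exact hz
  obtain ⟨y, hy, e⟩ := (periodic_circleMap c s).exists_mem_Ico Real.two_pi_pos t t₀
  rw [e] at hne ⊢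
  have hy0 : t₀ < y := lt_of_le_of_ne hy.1 fun h0 => hne (by rw [h0])
  have hper : ∀ t, circleMap c s (t + 2 * Real.pi) = circleMap c s t := periodic_circleMap c s
  have hvper : ∀ t, v (t + 2 * Real.pi) = v t := periodic_circleMap 0 s
  -- over a period only the summand `t I` of `Λ` changes, so the angle grows by exactly `2π`
  refine supporting_halfPlane_of_strictMono_angle (T := 2 * Real.pi)
    (γ := fun t => h (circleMap c s t) + conj (g (circleMap c s t)))
    (ψ := fun t => (Λ t).im) t₀ (fun t => Real.exp_pos _) hmono
    (Complex.continuous_im.comp hΛd.continuous) hγ ?_ (by simp only [hper]) hy0 hy.2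
  simp only [Λ, A, B, hper, hvper]
  simp
  ring

/-- A sense-preserving harmonic map is open: its real differential `v ↦ h' v + conj (g' v)` is
invertible where `|g'| < |h'|`. -/
theorem isOpen_image_of_norm_deriv_lt {h g : ℂ → ℂ} (hh : DifferentiableOn ℂ h disk)
    (hg : DifferentiableOn ℂ g disk) (hlt : ∀ z ∈ disk, ‖deriv g z‖ < ‖deriv h z‖) {U : Set ℂ}
    (hU : IsOpen U) (hsub : U ⊆ disk) : IsOpen ((fun z => h z + conj (g z)) '' U) := by
  rw [isOpen_iff_mem_nhds]
  rintro _ ⟨z, hz, rfl⟩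
  have hzd := hsub hz
  have h1 := (hh.analyticAt (isOpen_ball.mem_nhds hzd)).hasStrictDerivAt.hasStrictFDerivAt
    |>.restrictScalars ℝ
  have h2 := (hg.analyticAt (isOpen_ball.mem_nhds hzd)).hasStrictDerivAt.hasStrictFDerivAt
    |>.restrictScalars ℝ
  have h3 := h1.add ((Complex.conjCLE : ℂ →L[ℝ] ℂ).hasStrictFDerivAt.comp z h2)
  have hsurj := h3.map_nhds_eq_of_surj (LinearMap.range_eq_top.2
    (LinearMap.injective_iff_surjective.1 ((injective_iff_map_eq_zero _).2 fun x hx => by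
      have hx' : x * deriv h z + conj (x * deriv g z) = 0 := hx
      have h4 := congrArg norm (eq_neg_of_add_eq_zero_left hx')
      rw [norm_neg, Complex.norm_conj, norm_mul, norm_mul] at h4
      by_contra h0
      exact absurd h4 (mul_lt_mul_of_pos_left (hlt z hzd) (norm_pos_iff.2 h0)).ne')))
  change Filter.map (fun z => h z + conj (g z)) (nhds z) = nhds (h z + conj (g z)) at hsurj
  rw [← hsurj]
  exact Filter.image_mem_map (hU.mem_nhds hz)

/-- Every boundary point of the disk has a supporting half-plane that contains the images of all
other points of the closed disk in its interior. -/
theorem ConvexityData.exists_supporting (H : ConvexityData h g α κ) {c : ℂ} {s : ℝ}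
    (hs : 0 < s) (hsub : closedBall c s ⊆ disk)
    (hpos : 0 < 1 + s ^ 2 - ‖c‖ ^ 2 - 2 * (α + κ) * s) {z₀ : ℂ} (hz₀ : z₀ ∈ sphere c s) :
    ∃ e : ℂ, ∀ z ∈ closedBall c s, z ≠ z₀ →
      (((h z + conj (g z)) - (h z₀ + conj (g z₀))) * e).re < 0 := by
  obtain ⟨e, he, hsph⟩ := H.exists_supporting_on_sphere hs hsub hpos hz₀
  refine ⟨e, fun z hz hne => ?_⟩
  rcases (mem_closedBall.1 hz).eq_or_lt with hzs | hzs
  · exact hsph z hzs hne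
  -- `Re (e (h + conj g))` is the real part of the analytic function `e h + conj e g`
  set E : ℂ → ℂ := fun w => e * h w + conj e * g w
  have hE : ∀ w, ((h w + conj (g w)) * e).re = (E w).re := fun w => by
    simp only [E, Complex.add_re, Complex.mul_re, Complex.conj_re, Complex.conj_im, Complex.add_im]
    ring
  have hEd : DifferentiableOn ℂ (fun w => Complex.exp (E w)) disk :=
    ((H.diff_h.const_mul e).add (H.diff_g.const_mul (conj e))).cexp
  have hle : ∀ w ∈ ball c s, ((h w + conj (g w)) * e).re ≤ ((h z₀ + conj (g z₀)) * e).re := by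
    intro w hw
    have := Complex.norm_le_of_forall_mem_frontier_norm_le (U := ball c s) isBounded_ball
      ((hEd.mono (by rw [closure_ball _ hs.ne']; exact hsub)).diffContOnCl)
      (C := Real.exp (E z₀).re) (fun ξ hξ => by
        rw [frontier_ball _ hs.ne'] at hξ
        rw [Complex.norm_exp, Real.exp_le_exp]
        rcases eq_or_ne ξ z₀ with rfl | h0
        · exact le_rfl
        · have := hsph ξ hξ h0
          rw [sub_mul, Complex.sub_re, hE, hE] at this
          linarith) (subset_closure hw)
    rw [Complex.norm_exp, Real.exp_le_exp] at this
    rwa [hE, hE]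
  -- the image of the open disk is open, so it does not meet the boundary of the half-plane
  have hopen := isOpen_image_of_norm_deriv_lt H.diff_h H.diff_g H.norm_lt
    (isOpen_ball (x := c) (ε := s)) (ball_subset_closedBall.trans hsub)
  obtain ⟨ε, hε, hball⟩ := Metric.isOpen_iff.1 hopen _ ⟨z, mem_ball.2 hzs, rfl⟩
  have hepos : 0 < ‖e‖ := norm_pos_iff.2 he
  obtain ⟨w, hw, hweq⟩ := hball (show h z + conj (g z) + (ε / 2 / ‖e‖ : ℝ) * conj e ∈ _ by
    rw [mem_ball, dist_eq_norm, add_sub_cancel_left, norm_mul, Complex.norm_conj,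
      Complex.norm_real, Real.norm_of_nonneg (by positivity), div_mul_cancel₀ _ hepos.ne']
    linarith)
  have h1 := hle w hw
  simp only at hweq
  rw [hweq, add_mul, Complex.add_re, mul_assoc, mul_comm (conj e) e, Complex.mul_conj',
    Complex.re_ofReal_mul, ← Complex.ofReal_pow, Complex.ofReal_re] at h1
  have : 0 < ε / 2 / ‖e‖ * ‖e‖ ^ 2 := by positivity
  rw [sub_mul, Complex.sub_re]
  linarith

/-! ### From supporting half-planes to convexity -/

/-- Of two distinct points the one farther from `c` lies on a circle whose supporting half-plane
separates their images strictly. -/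
theorem injOn_ball_of_supporting {f : ℂ → ℂ} {c : ℂ} {s : ℝ}
    (H : ∀ r, 0 < r → r < s → ∀ z₀ ∈ sphere c r, ∃ e : ℂ, ∀ z ∈ closedBall c r, z ≠ z₀ →
      ((f z - f z₀) * e).re < 0) : InjOn f (ball c s) := by
  intro x hx y hy hxy
  wlog hle : dist x c ≤ dist y c generalizing x y
  · exact (this hy hx hxy.symm (le_of_not_ge hle)).symm
  by_contra hne
  have hpos : 0 < dist y c := by
    refine dist_nonneg.lt_of_ne fun h0 => hne ?_
    rw [← h0] at hle
    rw [dist_le_zero.1 hle, dist_eq_zero.1 h0.symm]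
  obtain ⟨e, he⟩ := H _ hpos hy y rfl
  have := he x hle hne
  rw [hxy, sub_self, zero_mul] at this
  exact lt_irrefl _ this

/-- The image of the open disk is open and relatively closed in the intersection of the supporting
open half-planes, because boundary points are mapped outside of this intersection. -/
theorem convex_image_ball_of_supporting {f : ℂ → ℂ} {c : ℂ} {r : ℝ} (hr : 0 < r)
    (hf : ContinuousOn f (closedBall c r)) (hopen : IsOpen (f '' ball c r))
    (H : ∀ z₀ ∈ sphere c r, ∃ e : ℂ, ∀ z ∈ closedBall c r, z ≠ z₀ →
      ((f z - f z₀) * e).re < 0) : Convex ℝ (f '' ball c r) := by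
  choose! e he using H
  -- the intersection of the supporting open half-planes
  set Ω : Set ℂ := ⋂ z₀ ∈ sphere c r, {w | ((w - f z₀) * e z₀).re < 0}
  have hΩ : Convex ℝ Ω := by
    refine convex_iInter₂ fun z₀ _ => ?_
    have : {w | ((w - f z₀) * e z₀).re < 0} = {w | (w * e z₀).re < (f z₀ * e z₀).re} := by
      ext w; simp only [mem_ofPred_eq, sub_mul, Complex.sub_re, sub_neg]
    rw [this]
    exact convex_halfSpace_lt (f := fun w : ℂ => (w * e z₀).re)
      ⟨fun x y => by simp [add_mul], fun a x => by simp [mul_assoc]⟩ _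
  have hsub : f '' ball c r ⊆ Ω := by
    rintro _ ⟨z, hz, rfl⟩
    refine mem_iInter₂.2 fun z₀ hz₀ => he z₀ hz₀ z (ball_subset_closedBall hz) fun h0 => ?_
    rw [h0] at hz
    exact (mem_ball.1 hz).ne hz₀
  have hcl : closure (f '' ball c r) ⊆ f '' closedBall c r :=
    closure_minimal (image_mono ball_subset_closedBall)
      ((isCompact_closedBall c r).image_of_continuousOn hf).isClosed
  have : Ω ⊆ f '' ball c r := by
    refine hΩ.isPreconnected.subset_of_closure_inter_subset hopen
      ⟨f c, hsub ⟨c, mem_ball_self hr, rfl⟩, c, mem_ball_self hr, rfl⟩ ?_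
    rintro w ⟨hw, hwΩ⟩
    obtain ⟨z, hz, rfl⟩ := hcl hw
    rcases (mem_closedBall.1 hz).eq_or_lt with hzr | hzr
    · have := mem_iInter₂.1 hwΩ z hzr
      simp at this
    · exact ⟨z, hzr, rfl⟩
  rwa [hsub.antisymm this]

/-- The condition `s ≤ α + κ` puts `s` to the left of the vertex of the parabola
`s ↦ 1 + s² - ‖c‖² - 2 (α + κ) s`, so that its positivity is inherited by all smaller radii. -/
theorem ConvexityData.convexInDisk (H : ConvexityData h g α κ) {f : ℂ → ℂ}
    (hf : ∀ z ∈ disk, f z = h z + conj (g z)) {c : ℂ} {s : ℝ} (hs : 0 < s)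
    (hsub : closedBall c s ⊆ disk) (hpos : 0 < 1 + s ^ 2 - ‖c‖ ^ 2 - 2 * (α + κ) * s)
    (hs1 : s ≤ α + κ) : ConvexInDisk f c s := by
  have hsup : ∀ r, 0 < r → r ≤ s → ∀ z₀ ∈ sphere c r, ∃ e : ℂ, ∀ z ∈ closedBall c r, z ≠ z₀ →
      ((f z - f z₀) * e).re < 0 := by
    intro r hr hrs z₀ hz₀
    have hsub' := (closedBall_subset_closedBall hrs).trans hsub
    obtain ⟨e, he⟩ := H.exists_supporting hr hsub' (by nlinarith) hz₀
    refine ⟨e, fun z hz hne => ?_⟩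
    rw [hf z (hsub' hz), hf z₀ (hsub' (sphere_subset_closedBall hz₀))]
    exact he z hz hne
  have hsubo : ball c s ⊆ disk := ball_subset_closedBall.trans hsub
  have hopen : IsOpen (f '' ball c s) := by
    rw [image_congr fun z hz => hf z (hsubo hz)]
    exact isOpen_image_of_norm_deriv_lt H.diff_h H.diff_g H.norm_lt isOpen_ball hsubo
  refine ⟨hsubo, injOn_ball_of_supporting fun r hr hrs => hsup r hr hrs.le,
    ⟨f c, c, mem_ball_self hs, rfl⟩, hopen,
    convex_image_ball_of_supporting hs ?_ hopen (hsup s hs le_rfl)⟩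
  have : ContinuousOn (fun z => h z + conj (g z)) (closedBall c s) :=
    (H.diff_h.continuousOn.mono hsub).add
      (Complex.continuous_conj.comp_continuousOn (H.diff_g.continuousOn.mono hsub))
  exact this.congr fun z hz => hf z (hsub hz)

/-! ### The radii of convexity -/

theorem dilatationBound_mem_Icc {Q : ℝ≥0∞} (hQ : 1 ≤ Q) : dilatationBound Q ∈ Icc (0 : ℝ) 1 := by
  unfold dilatationBound
  split_ifs with h
  · simp
  · have : 1 ≤ Q.toReal := by simpa using ENNReal.toReal_mono h hQ
    exact ⟨div_nonneg (by linarith) (by linarith), (div_le_one (by linarith)).2 (by linarith)⟩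

theorem le_alphaOne (α : ℝ) {Q : ℝ≥0∞} (hQ : 1 ≤ Q) : α ≤ alphaOne α Q := by
  unfold alphaOne
  split_ifs with h
  · exact le_rfl
  · have h1 := dilatationBound_mem_Icc hQ
    have hk : 0 < dilatationBound Q := h1.1.lt_of_ne' h
    have := (Real.sqrt_le_sqrt (show (dilatationBound Q)⁻¹ ^ 2 - 1 ≤ _ from
      sub_le_self _ zero_le_one)).trans_eq (Real.sqrt_sq (inv_pos.2 hk).le)
    linarith

/-- This includes the case `α₁ < 1`, in which the square root of a negative number is `0` and
`R₀ = α₁`. -/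
theorem rZero_mem_Ioc {α : ℝ} (hα : 0 < α) {Q : ℝ≥0∞} (hQ : 1 ≤ Q) : rZero α Q ∈ Ioc (0 : ℝ) 1 := by
  have h0 := hα.trans_le (le_alphaOne α hQ)
  unfold rZero
  set a := alphaOne α Q
  constructor
  · exact sub_pos.2 ((Real.sqrt_lt' h0).2 (by linarith))
  · rcases le_total a 1 with h | h
    · linarith [Real.sqrt_nonneg (a ^ 2 - 1)]
    · have : a - 1 ≤ √(a ^ 2 - 1) := Real.le_sqrt_of_sq_le (by nlinarith)
      linarith

theorem rZero_add_inv {α : ℝ} {Q : ℝ≥0∞} (h : 1 ≤ alphaOne α Q) :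
    rZero α Q + (rZero α Q)⁻¹ = 2 * alphaOne α Q := by
  have hs := Real.sq_sqrt (show 0 ≤ alphaOne α Q ^ 2 - 1 by nlinarith)
  have : (rZero α Q)⁻¹ = alphaOne α Q + √(alphaOne α Q ^ 2 - 1) := by
    refine inv_eq_of_mul_eq_one_right ?_
    unfold rZero
    linear_combination -hs
  rw [this, rZero]; ring

theorem convexityRadiusAt_zero {α : ℝ} {Q : ℝ≥0∞} (h : rZero α Q ∈ Ioc (0 : ℝ) 1) :
    convexityRadiusAt α Q 0 = rZero α Q := by
  have : 1 ≤ (rZero α Q)⁻¹ := (one_le_inv₀ h.1).2 h.2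
  have h2 := h.2
  rw [convexityRadiusAt, norm_zero, zero_pow two_ne_zero, mul_zero, add_zero, Real.sqrt_sq_eq_abs,
    abs_of_nonpos (by linarith)]
  ring

/-- The radius `R(z)` is the smaller root of `1 + s² - ‖z‖² - 2 α₁ s`. -/
theorem convexityRadiusAt_eq {α : ℝ} {Q : ℝ≥0∞} (h0 : rZero α Q ≠ 0) (h : 1 ≤ alphaOne α Q)
    (z : ℂ) : convexityRadiusAt α Q z
      = alphaOne α Q - √(alphaOne α Q ^ 2 - 1 + ‖z‖ ^ 2) := by
  have h1 := rZero_add_inv h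
  have h2 : (rZero α Q - (rZero α Q)⁻¹) ^ 2 + 4 * ‖z‖ ^ 2
      = 2 ^ 2 * (alphaOne α Q ^ 2 - 1 + ‖z‖ ^ 2) := by
    have h3 := mul_inv_cancel₀ h0
    linear_combination (rZero α Q + (rZero α Q)⁻¹ + 2 * alphaOne α Q) * h1 - 4 * h3
  rw [convexityRadiusAt, h1, h2, Real.sqrt_mul (by positivity), Real.sqrt_sq (by norm_num)]
  ring

theorem exists_convexityData {α : ℝ} (hα : 0 < α) {Q : ℝ≥0∞} (hQ : 1 ≤ Q) {f : ℂ → ℂ}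
    (hf : f ∈ classH α Q) : 1 ≤ α ∧ ∃ h g : ℂ → ℂ,
      ConvexityData h g α (alphaOne α Q - α) ∧ ∀ z ∈ disk, f z = h z + conj (g z) := by
  obtain ⟨h, g, hh, hg, -, -, hfz, -, hjac, hk, -, M, hM, ho, hm⟩ := hf
  have hlt : ∀ z ∈ disk, ‖deriv g z‖ < ‖deriv h z‖ := fun z hz =>
    lt_of_pow_lt_pow_left₀ 2 (norm_nonneg _) (sub_pos.1 (hjac z hz))
  have hne : ∀ z ∈ disk, deriv h z ≠ 0 := fun z hz =>
    norm_pos_iff.1 ((norm_nonneg _).trans_lt (hlt z hz))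
  have hP := (hM.preSchwarzianBound hα.le ho hm).of_div_const (hne 0 (by simp))
  refine ⟨hP.one_le hα.le hh hne, h, g, ⟨hh, hg, hlt, hP, fun z hz => ?_⟩, hfz⟩
  have hωd : DifferentiableOn ℂ (fun w => deriv g w / deriv h w) disk :=
    (hg.deriv isOpen_ball).div (hh.deriv isOpen_ball) hne
  have hkI := dilatationBound_mem_Icc hQ
  rcases eq_or_ne (dilatationBound Q) 0 with h0 | h0
  · have : (fun w => deriv g w / deriv h w) =ᶠ[nhds z] fun _ => 0 := by
      filter_upwards [isOpen_ball.mem_nhds hz] with w hw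
      exact norm_le_zero_iff.1 (h0 ▸ hk w hw)
    rw [this.deriv_eq, alphaOne, if_pos h0]
    simp
  · have := dilatation_deriv_le (hkI.1.lt_of_ne' h0) hkI.2 hωd hk hz
    rw [alphaOne, if_neg h0]
    convert this using 3
    ring

theorem convexInDisk_of_mem_classH {α : ℝ} (hα : 0 < α) {Q : ℝ≥0∞} (hQ : 1 ≤ Q) {f : ℂ → ℂ}
    (hf : f ∈ classH α Q) {z : ℂ} (hz : z ∈ disk) :
    ConvexInDisk f z (convexityRadiusAt α Q z) := by
  obtain ⟨hα1, h, g, H, hfz⟩ := exists_convexityData hα hQ hf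
  have ha := hα1.trans (le_alphaOne α hQ)
  have hz1 : ‖z‖ < 1 := by simpa using hz
  rw [convexityRadiusAt_eq (rZero_mem_Ioc hα hQ).1.ne' ha]
  set a := alphaOne α Q
  have hrad : 0 ≤ a ^ 2 - 1 + ‖z‖ ^ 2 := by nlinarith [sq_nonneg ‖z‖]
  have hsq := Real.sq_sqrt hrad
  set σ := √(a ^ 2 - 1 + ‖z‖ ^ 2)
  have hσ0 : 0 ≤ σ := Real.sqrt_nonneg _
  have hzσ : ‖z‖ ≤ σ := Real.le_sqrt_of_sq_le (by nlinarith)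
  have hσa : σ < a := by nlinarith [norm_nonneg z]
  have hadd : α + (a - α) = a := by ring
  -- `s < a - σ` is below the smaller root `a - σ` of `1 + s² - ‖z‖² - 2 a s`
  suffices ∀ s, 0 < s → s < a - σ → ConvexInDisk f z s by
    refine convexInDisk_of_forall_lt (by linarith) fun s hs => ?_
    obtain ⟨r, hr, hr'⟩ := exists_between (max_lt hs (sub_pos.2 hσa))
    exact ⟨r, ⟨(le_max_left _ _).trans_lt hr, hr'.le⟩, this r ((le_max_right _ _).trans_lt hr) hr'⟩
  intro s hs hsR
  refine H.convexInDisk hfz hs ?_ ?_ (by linarith)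
  · refine closedBall_subset_ball' ?_
    rw [dist_zero_right]
    by_contra! hge
    nlinarith [norm_nonneg z]
  · rw [hadd]; nlinarith

/-- The supremum of the admissible radii is admissible, so a radius of convexity exists as soon as
some radius is admissible. -/
theorem exists_isRadiusOfConvexity {F : Set (ℂ → ℂ)} {r : ℝ} (hr : r ∈ Ioc (0 : ℝ) 1)
    (hF : ∀ f ∈ F, ConvexInDisk f 0 r) : ∃ ρ, IsRadiusOfConvexity F ρ ∧ r ≤ ρ := by
  set S := {r : ℝ | 0 < r ∧ r ≤ 1 ∧ ∀ f ∈ F, ConvexInDisk f 0 r}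
  have hrS : r ∈ S := ⟨hr.1, hr.2, hF⟩
  have hbdd : BddAbove S := ⟨1, fun _ h => h.2.1⟩
  have hle : r ≤ sSup S := le_csSup hbdd hrS
  refine ⟨sSup S, ⟨⟨hr.1.trans_le hle, csSup_le ⟨r, hrS⟩ fun _ h => h.2.1, fun f hf => ?_⟩,
    fun _ h => le_csSup hbdd h⟩, hle⟩
  refine convexInDisk_of_forall_lt (hr.1.trans_le hle) fun s hs => ?_
  obtain ⟨t, ht, hst⟩ := exists_lt_of_lt_csSup ⟨r, hrS⟩ hs
  exact ⟨t, ⟨hst, le_csSup hbdd ht⟩, ht.2.2 f hf⟩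

end HarmonicMap

theorem theorem3 (α : ℝ) (hα : 0 < α) (Q : ENNReal) (hQ : 1 ≤ Q) :
    (∀ f ∈ HarmonicMap.classH α Q, ∀ z ∈ HarmonicMap.disk,
      HarmonicMap.ConvexInDisk f z (HarmonicMap.convexityRadiusAt α Q z)) ∧
    (∃ ρ : ℝ, HarmonicMap.IsRadiusOfConvexity (HarmonicMap.classH α Q) ρ ∧
      HarmonicMap.rZero α Q ≤ ρ) := by
  have h0 := HarmonicMap.rZero_mem_Ioc hα hQ
  refine ⟨fun f hf z hz => HarmonicMap.convexInDisk_of_mem_classH hα hQ hf hz,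
    HarmonicMap.exists_isRadiusOfConvexity h0 fun f hf => ?_⟩
  rw [← HarmonicMap.convexityRadiusAt_zero h0]
  exact HarmonicMap.convexInDisk_of_mem_classH hα hQ hf (by simp)
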